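/- Let $\varphi_e$ be the partial computable function on $\mathbb N$ with index $e$ in a standard enumeration, $W_e=\operatorname{dom}\varphi_e$, and let $\langle\cdot,\cdot\rangle$ be a computable bijection $\mathbb N^2\to\mathbb N$. For $e\in\mathbb N$ let $R_e$ be the equivalence relation on $\mathbb N$ generated by $\{(x,y) : \langle x,y\rangle\in W_e\}$; the relations $R_e$ are exactly the computably enumerable equivalence relations (ceers) on $\mathbb N$. Let $\omega$ be the identity relation on $\mathbb N$. For equivalence relations $R,S$ on $\mathbb N$, write $R\le S$ if there is a total computable function $f:\mathbb N\to\mathbb N$ such that $x\,R\,y\Leftrightarrow f(x)\,S\,f(y)$ for all $x,y\in\mathbb N$, and write $R\equiv S$ if $R\le S$ and $S\le R$. A set $A$ (of natural numbers or of pairs of natural numbers) is $\Sigma_3$ if there is a computable predicate $Q$ such that $a\in A\Leftrightarrow\exists x\,\forall y\,\exists z\,Q(a,x,y,z)$. It is $\Sigma_3$-complete if it is $\Sigma_3$ and for every $\Sigma_3$ set $B\subseteq\mathbb N$ there is an injective total computable function $g$ such that $n\in B\Leftrightarrow g(n)\in A$ for all $n$ (in particular, $B$ is many-one reducible to $A$).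 **Corollary 4.8.** The reducibility and the bi-reducibility among ceers are $\Sigma_3$-complete; that is, the sets $$\{(e,i)\in\mathbb N^2 : R_e\le R_i\}\quad\text{and}\quad\{(e,i)\in\mathbb N^2 : R_e\equiv R_i\}$$ are $\Sigma_3$-complete. Moreover, the set $\{e\in\mathbb N : R_e\equiv\omega\}$ is $\Sigma_3$-complete. -/

import Mathlib

/-- `phi e` is the partial computable function with index `e`. -/
def phi (e : ℕ) : ℕ →. ℕ :=
  Nat.Partrec.Code.eval (Denumerable.ofNat Nat.Partrec.Code e)

/-- `W e` is the c.e. set with index `e`, the domain of `phi e`. -/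
def W (e : ℕ) : Set ℕ :=
  {x | (phi e x).Dom}

/-- `ceer e` is the ceer with canonical c.e. index `e`: the equivalence relation on `ℕ`
generated by the pairs `(x, y)` whose code belongs to `W e`. -/
def ceer (e : ℕ) : Setoid ℕ :=
  Relation.EqvGen.setoid fun x y => Nat.pair x y ∈ W e

/-- The identity relation on `ℕ`, denoted `ω` or `id(ℕ)` in the theory of ceers. -/
def ceerOmega : Setoid ℕ where
  r x y := x = y
  iseqv := eq_equivalence

/-- `R` is reducible to `S`: some total computable `f` satisfies `x R y ↔ f x S f y`. -/
def CeerReducible (R S : Setoid ℕ) : Prop :=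
  ∃ f : ℕ → ℕ, Computable f ∧ ∀ x y, R x y ↔ S (f x) (f y)

/-- `R` and `S` are bi-reducible: each is reducible to the other. -/
def CeerBireducible (R S : Setoid ℕ) : Prop :=
  CeerReducible R S ∧ CeerReducible S R

/-- The class `Σ₃` of the arithmetical hierarchy: `a ∈ A ↔ ∃ x, ∀ y, ∃ z, Q (a, x, y, z)`
for some computable predicate `Q`. -/
def IsSigma3 {α : Type} [Primcodable α] (A : Set α) : Prop :=
  ∃ Q : α × ℕ × ℕ × ℕ → Prop, ComputablePred Q ∧
    ∀ a, a ∈ A ↔ ∃ x, ∀ y, ∃ z, Q (a, x, y, z)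

/-- `A` is `Σ₃`-complete: it is `Σ₃`, and every `Σ₃` set of natural numbers is reducible to it
by an injective total computable function (in particular, it is many-one reducible to it). -/
def IsSigma3Complete {α : Type} [Primcodable α] (A : Set α) : Prop :=
  IsSigma3 A ∧ ∀ B : Set ℕ, IsSigma3 B → OneOneReducible (· ∈ B) (· ∈ A)

/-! Upper bound: `ceer e x y` is a `Σ₁` condition, so "`phi d` is total and reduces one ceer to the
other" is `Π₂`, and quantifying over `d` gives `Σ₃`. Bireducibility intersects this set with its
mirror image, and since `ω` is itself a ceer, its degree is a section of the bireducibility set.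

Hardness: a ceer whose only possibly nontrivial class is a c.e. set `C` reduces to `ω` exactly when
`C` is computable. So it suffices to build, uniformly in `n`, a c.e. set that is computable iff `n ∈
B`. Membership in `B` is first put in the form "some section of a c.e. set is infinite", and a
computable `f` counts the entries of each section. The deficiency set of `f` is cofinite if some
value recurs infinitely often. If every value has finite fiber, a nondeficient stage with large
value bounds all stages at which smaller values occur; the odd sections code the halting problem, so
a computable deficiency set would decide it. Doubling the set keeps the odd numbers as singletons,
so that `ω` embeds in the ceer. Outside `B` even `≤ ω` fails, hence one map `g` serves all three
sets. -/

open Nat.Partrec (Code)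
open Nat.Partrec.Code Denumerable Encodable

/-! ### Ceers as unions of computable stages -/

/-- Whether `phi e x` converges within `t` steps. -/
def haltsWithin (t e x : ℕ) : Bool :=
  (evaln t (ofNat Code e) x).isSome

theorem mem_W_iff_haltsWithin {e x : ℕ} : x ∈ W e ↔ ∃ t, haltsWithin t e x = true := by
  simp only [W, phi, Set.mem_ofPred_eq, Part.dom_iff_mem, evaln_complete, haltsWithin,
    Option.isSome_iff_exists, Option.mem_def]
  exact exists_comm

theorem haltsWithin_mono {s t e x : ℕ} (hst : s ≤ t) (h : haltsWithin s e x = true) :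
    haltsWithin t e x = true := by
  simp only [haltsWithin, Option.isSome_iff_exists] at h ⊢
  exact h.imp fun a ha => evaln_mono hst ha

theorem primrec_evaln_ofNat {α : Type} [Primcodable α] {t e x : α → ℕ} (ht : Primrec t)
    (he : Primrec e) (hx : Primrec x) :
    Primrec fun a => evaln (t a) (ofNat Code (e a)) (x a) :=
  primrec_evaln.comp ((ht.pair ((Primrec.ofNat Code).comp he)).pair hx)

theorem primrec_haltsWithin {α : Type} [Primcodable α] {t e x : α → ℕ} (ht : Primrec t)
    (he : Primrec e) (hx : Primrec x) : Primrec fun a => haltsWithin (t a) (e a) (x a) :=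
  Primrec.option_isSome.comp (primrec_evaln_ofNat ht he hx)

/-- Move from `u` to `h.1` if the two are seen to be `ceer e`-related by stage `h.2`. -/
def ceerStep (e u : ℕ) (h : ℕ × ℕ) : ℕ :=
  bif haltsWithin h.2 e (Nat.pair u h.1) || haltsWithin h.2 e (Nat.pair h.1 u) then h.1 else u

/-- The element reached from `u` by following the list of steps with code `s`. -/
def ceerWalk (e u s : ℕ) : ℕ :=
  (ofNat (List (ℕ × ℕ)) s).foldl (ceerStep e) u

theorem primrec_ceerWalk {α : Type} [Primcodable α] {e u s : α → ℕ} (he : Primrec e)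
    (hu : Primrec u) (hs : Primrec s) : Primrec fun a => ceerWalk (e a) (u a) (s a) := by
  refine Primrec.list_foldl ((Primrec.ofNat (List (ℕ × ℕ))).comp hs) hu
    (h := fun a p => ceerStep (e a) p.1 p.2) ?_
  have he' : Primrec fun p : α × ℕ × ℕ × ℕ => e p.1 := he.comp Primrec.fst
  have hv : Primrec fun p : α × ℕ × ℕ × ℕ => p.2.2.1 :=
    Primrec.fst.comp (Primrec.snd.comp Primrec.snd)
  have ht : Primrec fun p : α × ℕ × ℕ × ℕ => p.2.2.2 :=
    Primrec.snd.comp (Primrec.snd.comp Primrec.snd)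
  have hw : Primrec fun p : α × ℕ × ℕ × ℕ => p.2.1 := Primrec.fst.comp Primrec.snd
  exact Primrec.cond (Primrec.or.comp
    (primrec_haltsWithin ht he' (Primrec₂.natPair.comp hw hv))
    (primrec_haltsWithin ht he' (Primrec₂.natPair.comp hv hw))) hv hw

theorem ceer_ceerStep (e u : ℕ) (h : ℕ × ℕ) : ceer e u (ceerStep e u h) := by
  unfold ceerStep
  cases hh : haltsWithin h.2 e (Nat.pair u h.1) || haltsWithin h.2 e (Nat.pair h.1 u)
  · exact Relation.EqvGen.refl _
  · rcases Bool.or_eq_true_iff.1 hh with hh | hh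
    · exact Relation.EqvGen.rel _ _ (mem_W_iff_haltsWithin.2 ⟨_, hh⟩)
    · exact Relation.EqvGen.symm _ _ (Relation.EqvGen.rel _ _ (mem_W_iff_haltsWithin.2 ⟨_, hh⟩))

theorem ceer_foldl_ceerStep (e : ℕ) (l : List (ℕ × ℕ)) (u : ℕ) :
    ceer e u (l.foldl (ceerStep e) u) := by
  induction l generalizing u with
  | nil => exact Relation.EqvGen.refl _
  | cons h l ih => exact Relation.EqvGen.trans _ _ _ (ceer_ceerStep e u h) (ih _)

/-- A walk is undone step by step, aiming back at `u` with the same stage: `ceerStep` tests both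
orientations, and if the original step was idle then aiming at `u` from `u` changes nothing. -/
theorem exists_foldl_ceerStep_symm (e : ℕ) (l : List (ℕ × ℕ)) (u : ℕ) :
    ∃ l' : List (ℕ × ℕ), l'.foldl (ceerStep e) (l.foldl (ceerStep e) u) = u := by
  induction l generalizing u with
  | nil => exact ⟨[], rfl⟩
  | cons h l ih =>
    obtain ⟨l', hl'⟩ := ih (ceerStep e u h)
    refine ⟨l' ++ [(u, h.2)], ?_⟩
    rw [List.foldl_append, List.foldl_cons (l := l), hl', List.foldl_cons, List.foldl_nil]
    unfold ceerStep
    cases hh : haltsWithin h.2 e (Nat.pair u h.1) || haltsWithin h.2 e (Nat.pair h.1 u)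
    · simp
    · rw [Bool.or_comm] at hh
      simp [hh]

/-- Unjustified steps are ignored, so every code is a legal walk; this makes `ceer e` a `Σ₁`
relation with primitive recursive matrix. -/
theorem ceer_iff_exists_ceerWalk {e x y : ℕ} : ceer e x y ↔ ∃ s, ceerWalk e x s = y := by
  constructor
  · suffices h : ceer e x y → ∃ l : List (ℕ × ℕ), l.foldl (ceerStep e) x = y by
      intro hxy
      obtain ⟨l, hl⟩ := h hxy
      exact ⟨encode l, by rw [ceerWalk, ofNat_encode, hl]⟩
    intro h
    induction h with
    | rel x y h =>
      obtain ⟨t, ht⟩ := mem_W_iff_haltsWithin.1 h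
      exact ⟨[(y, t)], by simp [ceerStep, ht]⟩
    | refl x => exact ⟨[], rfl⟩
    | symm x y _ ih =>
      obtain ⟨l, rfl⟩ := ih
      exact exists_foldl_ceerStep_symm e l x
    | trans x y z _ _ ih₁ ih₂ =>
      obtain ⟨l₁, rfl⟩ := ih₁
      obtain ⟨l₂, rfl⟩ := ih₂
      exact ⟨l₁ ++ l₂, by rw [List.foldl_append]⟩
  · rintro ⟨s, rfl⟩
    exact ceer_foldl_ceerStep e _ x

/-! ### Reducibility is `Σ₃` -/

theorem IsSigma3.preimage {α β : Type} [Primcodable α] [Primcodable β] {A : Set β}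
    (hA : IsSigma3 A) {f : α → β} (hf : Computable f) : IsSigma3 (f ⁻¹' A) := by
  obtain ⟨Q, hQ, h⟩ := hA
  refine ⟨fun p => Q (f p.1, p.2), ?_, fun a => h (f a)⟩
  obtain ⟨q, hq, rfl⟩ := ComputablePred.computable_iff.1 hQ
  exact ComputablePred.computable_iff.2
    ⟨_, hq.comp ((hf.comp Computable.fst).pair Computable.snd), rfl⟩

theorem IsSigma3.inter {α : Type} [Primcodable α] {A B : Set α}
    (hA : IsSigma3 A) (hB : IsSigma3 B) : IsSigma3 (A ∩ B) := by
  obtain ⟨Q, hQ, hA⟩ := hA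
  obtain ⟨R, hR, hB⟩ := hB
  obtain ⟨q, hq, rfl⟩ := ComputablePred.computable_iff.1 hQ
  obtain ⟨r, hr, rfl⟩ := ComputablePred.computable_iff.1 hR
  have hx : Computable fun p : α × ℕ × ℕ × ℕ => p.2.1.unpair :=
    Computable.unpair.comp (Computable.fst.comp Computable.snd)
  have hz : Computable fun p : α × ℕ × ℕ × ℕ => p.2.2.2.unpair :=
    Computable.unpair.comp (Computable.snd.comp (Computable.snd.comp Computable.snd))
  have hy : Computable fun p : α × ℕ × ℕ × ℕ => p.2.2.1 :=
    Computable.fst.comp (Computable.snd.comp Computable.snd)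
  refine ⟨_, ComputablePred.computable_iff.2 ⟨fun p =>
    q (p.1, p.2.1.unpair.1, p.2.2.1, p.2.2.2.unpair.1) &&
      r (p.1, p.2.1.unpair.2, p.2.2.1, p.2.2.2.unpair.2), ?_, rfl⟩, fun a => ?_⟩
  · exact Primrec.and.to_comp.comp
      (hq.comp (Computable.fst.pair ((Computable.fst.comp hx).pair
        (hy.pair (Computable.fst.comp hz)))))
      (hr.comp (Computable.fst.pair ((Computable.snd.comp hx).pair
        (hy.pair (Computable.snd.comp hz)))))
  · simp only [Set.mem_inter_iff, hA, hB, Bool.and_eq_true]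
    constructor
    · rintro ⟨⟨x₁, h₁⟩, ⟨x₂, h₂⟩⟩
      refine ⟨Nat.pair x₁ x₂, fun y => ?_⟩
      obtain ⟨z₁, h₁⟩ := h₁ y
      obtain ⟨z₂, h₂⟩ := h₂ y
      exact ⟨Nat.pair z₁ z₂, by simpa using ⟨h₁, h₂⟩⟩
    · rintro ⟨x, h⟩
      exact ⟨⟨_, fun y => (h y).imp' (fun z => z.unpair.1) fun z hz => hz.1⟩,
        ⟨_, fun y => (h y).imp' (fun z => z.unpair.2) fun z hz => hz.2⟩⟩

theorem exists_index {f : ℕ →. ℕ} (hf : Partrec f) : ∃ e, phi e = f := by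
  obtain ⟨c, hc⟩ := exists_code.1 (Partrec.nat_iff.1 hf)
  exact ⟨encode c, by rw [phi, ofNat_encode, hc]⟩

/-- `reductionTest (e, i) d ⟨x, y, s⟩ ⟨t, s₁, s₂⟩` checks that `phi d` converges on `x` and `y`
within `t` steps, and that if `x ceer e y` or `phi d x ceer i phi d y` is witnessed by `s` then
both are witnessed, by `s₁` and `s₂`. -/
def reductionTest (p : (ℕ × ℕ) × ℕ × ℕ × ℕ) : Prop :=
  let e := p.1.1
  let i := p.1.2
  let d := p.2.1
  let x := p.2.2.1.unpair.1
  let y := p.2.2.1.unpair.2.unpair.1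
  let s := p.2.2.1.unpair.2.unpair.2
  let t := p.2.2.2.unpair.1
  let s₁ := p.2.2.2.unpair.2.unpair.1
  let s₂ := p.2.2.2.unpair.2.unpair.2
  let u := (evaln t (ofNat Code d) x).getD 0
  let v := (evaln t (ofNat Code d) y).getD 0
  (haltsWithin t d x = true ∧ haltsWithin t d y = true) ∧
    ((¬ ceerWalk e x s = y ∧ ¬ ceerWalk i u s = v) ∨ (ceerWalk e x s₁ = y ∧ ceerWalk i u s₂ = v))

theorem primrecPred_reductionTest : PrimrecPred reductionTest := by
  have he : Primrec fun p : (ℕ × ℕ) × ℕ × ℕ × ℕ => p.1.1 := Primrec.fst.comp Primrec.fst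
  have hi : Primrec fun p : (ℕ × ℕ) × ℕ × ℕ × ℕ => p.1.2 := Primrec.snd.comp Primrec.fst
  have hd : Primrec fun p : (ℕ × ℕ) × ℕ × ℕ × ℕ => p.2.1 := Primrec.fst.comp Primrec.snd
  have hY : Primrec fun p : (ℕ × ℕ) × ℕ × ℕ × ℕ => p.2.2.1.unpair :=
    Primrec.unpair.comp (Primrec.fst.comp (Primrec.snd.comp Primrec.snd))
  have hZ : Primrec fun p : (ℕ × ℕ) × ℕ × ℕ × ℕ => p.2.2.2.unpair :=
    Primrec.unpair.comp (Primrec.snd.comp (Primrec.snd.comp Primrec.snd))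
  have hY' := Primrec.unpair.comp (Primrec.snd.comp hY)
  have hZ' := Primrec.unpair.comp (Primrec.snd.comp hZ)
  have hx := Primrec.fst.comp hY
  have hy := Primrec.fst.comp hY'
  have hs := Primrec.snd.comp hY'
  have ht := Primrec.fst.comp hZ
  have hs₁ := Primrec.fst.comp hZ'
  have hs₂ := Primrec.snd.comp hZ'
  have hu := Primrec.option_getD.comp (primrec_evaln_ofNat ht hd hx) (Primrec.const 0)
  have hv := Primrec.option_getD.comp (primrec_evaln_ofNat ht hd hy) (Primrec.const 0)
  exact ((Primrec.eq.comp (primrec_haltsWithin ht hd hx) (Primrec.const true)).and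
    (Primrec.eq.comp (primrec_haltsWithin ht hd hy) (Primrec.const true))).and
    (((Primrec.eq.comp (primrec_ceerWalk he hx hs) hy).not.and
      (Primrec.eq.comp (primrec_ceerWalk hi hu hs) hv).not).or
    ((Primrec.eq.comp (primrec_ceerWalk he hx hs₁) hy).and
      (Primrec.eq.comp (primrec_ceerWalk hi hu hs₂) hv)))

theorem haltsWithin_iff_mem {t d x : ℕ} :
    haltsWithin t d x = true ↔ (evaln t (ofNat Code d) x).getD 0 ∈ evaln t (ofNat Code d) x := by
  unfold haltsWithin
  cases evaln t (ofNat Code d) x <;> simp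

/-- An equivalence of two `Σ₁` statements is `Π₂`: any witness `s` of either side must be matched by
witnesses of both. -/
theorem isSigma3_ceerReducible :
    IsSigma3 {p : ℕ × ℕ | CeerReducible (ceer p.1) (ceer p.2)} := by
  refine ⟨reductionTest, primrecPred_reductionTest.computablePred, ?_⟩
  rintro ⟨e, i⟩
  constructor
  · rintro ⟨f, hf, h⟩
    obtain ⟨d, hd⟩ := exists_index hf.partrec
    have hconv (x : ℕ) : ∃ t, f x ∈ evaln t (ofNat Code d) x := by
      rw [← evaln_complete]
      change f x ∈ phi d x
      rw [hd]
      exact Part.mem_some _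
    refine ⟨d, fun Y => ?_⟩
    obtain ⟨t₁, ht₁⟩ := hconv Y.unpair.1
    obtain ⟨t₂, ht₂⟩ := hconv Y.unpair.2.unpair.1
    replace ht₁ := Option.mem_def.1 (evaln_mono (le_max_left t₁ t₂) ht₁)
    replace ht₂ := Option.mem_def.1 (evaln_mono (le_max_right t₁ t₂) ht₂)
    have hW := h Y.unpair.1 Y.unpair.2.unpair.1
    by_cases hR : ceer e Y.unpair.1 Y.unpair.2.unpair.1
    · obtain ⟨s₁, hs₁⟩ := ceer_iff_exists_ceerWalk.1 hR
      obtain ⟨s₂, hs₂⟩ := ceer_iff_exists_ceerWalk.1 (hW.1 hR)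
      refine ⟨Nat.pair (max t₁ t₂) (Nat.pair s₁ s₂), ?_⟩
      simp [reductionTest, haltsWithin, ht₁, ht₂, hs₁, hs₂]
    · have hS := mt hW.2 hR
      rw [ceer_iff_exists_ceerWalk, not_exists] at hR hS
      refine ⟨Nat.pair (max t₁ t₂) (Nat.pair 0 0), ?_⟩
      simp [reductionTest, haltsWithin, ht₁, ht₂, hR, hS]
  · rintro ⟨d, h⟩
    have htot (x : ℕ) : (phi d x).Dom := by
      -- Every query tests convergence, so the choices `y = x` and `s = 0` are arbitrary.
      obtain ⟨Z, ⟨hx, -⟩, -⟩ := h (Nat.pair x (Nat.pair x 0))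
      simp only [Nat.unpair_pair] at hx
      exact mem_W_iff_haltsWithin.2 ⟨_, hx⟩
    have hspec (x t : ℕ) (ht : haltsWithin t d x = true) :
        (evaln t (ofNat Code d) x).getD 0 = (phi d x).get (htot x) :=
      Part.mem_unique (evaln_sound (haltsWithin_iff_mem.1 ht)) (Part.get_mem _)
    refine ⟨fun x => (phi d x).get (htot x), ?_, fun x y => ?_⟩
    · refine Partrec.of_eq_tot (Partrec.nat_iff.2 (exists_code.2 ⟨_, rfl⟩) : Partrec (phi d))
        fun x => Part.get_mem _
    · simp only [ceer_iff_exists_ceerWalk]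
      constructor
      · rintro ⟨s, hs⟩
        obtain ⟨Z, ⟨hx, hy⟩, hxy⟩ := h (Nat.pair x (Nat.pair y s))
        simp only [Nat.unpair_pair] at hx hy hxy
        rw [hspec _ _ hx, hspec _ _ hy] at hxy
        rcases hxy with hxy | hxy
        · exact absurd hs hxy.1
        · exact ⟨_, hxy.2⟩
      · rintro ⟨s, hs⟩
        obtain ⟨Z, ⟨hx, hy⟩, hxy⟩ := h (Nat.pair x (Nat.pair y s))
        simp only [Nat.unpair_pair] at hx hy hxy
        rw [hspec _ _ hx, hspec _ _ hy] at hxy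
        rcases hxy with hxy | hxy
        · exact absurd hs hxy.2
        · exact ⟨_, hxy.1⟩

theorem isSigma3_ceerBireducible :
    IsSigma3 {p : ℕ × ℕ | CeerBireducible (ceer p.1) (ceer p.2)} :=
  isSigma3_ceerReducible.inter
    (isSigma3_ceerReducible.preimage (f := Prod.swap) (Computable.snd.pair Computable.fst))

theorem exists_ceer_eq_ceerOmega : ∃ i, ceer i = ceerOmega := by
  obtain ⟨i, hi⟩ := exists_index (f := fun _ => Part.none) Partrec.none
  refine ⟨i, Setoid.ext fun x y => ⟨fun h => ?_, ?_⟩⟩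
  · refine Relation.EqvGen.rec (motive := fun x y _ => x = y) (fun x y h => ?_) (fun _ => rfl)
      (fun _ _ _ h => h.symm) (fun _ _ _ _ _ h₁ h₂ => h₁.trans h₂) h
    have : (phi i (Nat.pair x y)).Dom := h
    rw [hi] at this
    exact this.elim
  · rintro rfl
    exact Relation.EqvGen.refl _
/-! ### Deficiency sets -/

/-- The deficiency set of `f`: the stages after which some value at most the present one appears. -/
def deficiencySet (f : ℕ → ℕ) : Set ℕ :=
  {s | ∃ t, s < t ∧ f t ≤ f s}

/-- A stage with value at least `v` is followed by another `v`, so nondeficient stages have values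
below `v`; and `f` is injective on them. -/
theorem finite_compl_deficiencySet {f : ℕ → ℕ} {v : ℕ} (h : {s | f s = v}.Infinite) :
    (deficiencySet f)ᶜ.Finite := by
  refine Set.Finite.of_finite_image (f := f) ((Set.finite_Iio v).subset ?_) ?_
  · rintro _ ⟨s, hs, rfl⟩
    obtain ⟨t, ht, hst⟩ := h.exists_gt s
    by_contra hv
    exact hs ⟨t, hst, (show f t = v from ht).trans_le (not_lt.1 hv)⟩
  · intro s hs t ht hst
    rcases lt_trichotomy s t with h | h | h
    · exact absurd ⟨t, h, hst.ge⟩ hs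
    · exact h
    · exact absurd ⟨s, h, hst.le⟩ ht

theorem exists_notMem_deficiencySet {f : ℕ → ℕ} (h : ∀ v, {s | f s = v}.Finite) (v : ℕ) :
    ∃ s, s ∉ deficiencySet f ∧ v ≤ f s := by
  have hv : {s | f s < v}.Finite := by
    refine ((Set.finite_Iio v).biUnion fun w _ => h w).subset fun s hs => ?_
    exact Set.mem_biUnion (show f s ∈ Set.Iio v from hs) rfl
  obtain ⟨N, hN⟩ := hv.bddAbove
  have hN' (s : ℕ) (hs : N < s) : v ≤ f s := by
    by_contra hlt
    exact absurd (hN (show f s < v from not_le.1 hlt)) (not_le.2 hs)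
  -- The last stage attaining the least value taken after `N` is nondeficient.
  have hex : ∃ w s, N < s ∧ f s = w := ⟨_, N + 1, N.lt_succ_self, rfl⟩
  classical
  obtain ⟨s₀, hs₀, hw⟩ := Nat.find_spec hex
  have hfin : {s | N < s ∧ f s = Nat.find hex}.Finite := (h _).subset fun s hs => hs.2
  obtain ⟨s, ⟨hs, hsw⟩, hmax⟩ := Set.exists_max_image _ id hfin ⟨s₀, hs₀, hw⟩
  refine ⟨s, ?_, hN' s hs⟩
  rintro ⟨t, hst, hts⟩
  have h1 : Nat.find hex ≤ f t := Nat.find_min' hex ⟨t, hs.trans hst, rfl⟩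
  exact absurd (hmax t ⟨hs.trans hst, le_antisymm (hts.trans hsw.le) h1⟩) (not_le.2 hst)

theorem le_of_notMem_deficiencySet {f : ℕ → ℕ} {s t : ℕ} (hs : s ∉ deficiencySet f)
    (h : f t ≤ f s) : t ≤ s := by
  by_contra hlt
  exact hs ⟨t, not_le.1 hlt, h⟩

/-! ### Normal form for `Σ₃` sets -/

theorem not_computablePred_zero_mem_W : ¬ ComputablePred fun k => 0 ∈ W k := by
  intro h
  obtain ⟨q, hq, hqk⟩ := ComputablePred.computable_iff.1 h
  refine ComputablePred.halting_problem 0 ((ComputablePred.computable_iff.2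
    ⟨_, hq.comp Computable.encode, rfl⟩).of_eq fun c => ?_)
  have := congrFun hqk (encode c)
  simp only [W, phi, Set.mem_ofPred_eq, ofNat_encode] at this
  exact Iff.of_eq this.symm

theorem partrec_phi : Partrec₂ phi :=
  eval_part.comp ((Computable.ofNat Code).comp Computable.fst) Computable.snd

theorem rfind_some_dom {q : ℕ → Bool} :
    (Nat.rfind fun z => Part.some (q z)).Dom ↔ ∃ z, q z = true :=
  Nat.rfind_dom.trans ⟨fun ⟨n, h, _⟩ => ⟨n, (Part.mem_some_iff.1 h).symm⟩,
    fun ⟨n, h⟩ => ⟨n, Part.mem_some_iff.2 h.symm, fun _ => trivial⟩⟩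

theorem dom_natRec_bind_iff {g : ℕ → Part ℕ} {y : ℕ} :
    (Nat.rec (Part.some 0) (fun k ih => ih.bind fun _ => g k) y : Part ℕ).Dom ↔
      ∀ k < y, (g k).Dom := by
  induction y with
  | zero => simp
  | succ y ih =>
    rw [Nat.forall_lt_succ_right, ← ih]
    simp [Part.bind_dom]

/-- A `Σ₃` set is described by a c.e. set of triples `(n, x, y)`: `n` belongs to it exactly when
some section is infinite. The even sections do this, and the odd ones encode the halting problem. -/
theorem IsSigma3.exists_index {B : Set ℕ} (hB : IsSigma3 B) : ∃ c,
    (∀ n, n ∈ B ↔ ∃ x, {y | Nat.pair n (Nat.pair x y) ∈ W c}.Infinite) ∧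
    ∀ n k, Nat.pair n (Nat.pair (2 * k + 1) 0) ∈ W c ↔ 0 ∈ W k := by
  obtain ⟨Q, hQ, hB⟩ := hB
  obtain ⟨q, hq, rfl⟩ := ComputablePred.computable_iff.1 hQ
  let G (n x y : ℕ) : Part ℕ := Nat.rfind fun z => Part.some (q (n, x, y, z))
  have hGdom (n x y : ℕ) : (G n x y).Dom ↔ ∃ z, q (n, x, y, z) = true :=
    rfind_some_dom
  -- Even section `2k` is the initial segment of those `y` for which the searches at all `y' < y`
  -- succeed, so it is infinite iff `∀ y, ∃ z` holds at `k`. An odd section contains at most `0` and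
  -- so never affects membership in `B`.
  let F (p : ℕ) : Part ℕ :=
    bif p.unpair.2.unpair.1.bodd then
      bif decide (p.unpair.2.unpair.2 = 0) then phi p.unpair.2.unpair.1.div2 0 else Part.none
    else Nat.rec (Part.some 0)
      (fun y ih => ih.bind fun _ => G p.unpair.1 p.unpair.2.unpair.1.div2 y) p.unpair.2.unpair.2
  have hn : Computable fun p : ℕ => p.unpair.1 := Computable.fst.comp Computable.unpair
  have hs : Computable fun p : ℕ => p.unpair.2.unpair :=
    Computable.unpair.comp (Computable.snd.comp Computable.unpair)
  have hx := Computable.fst.comp hs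
  have hy := Computable.snd.comp hs
  have hF : Partrec F := by
    refine Partrec.cond (Computable.nat_bodd.comp hx) (Partrec.cond ?_ ?_ Partrec.none)
      (Partrec.nat_rec (g := fun _ => Part.some 0) hy (Computable.const 0).partrec (h := fun p r =>
        G p.unpair.1 p.unpair.2.unpair.1.div2 r.1) ?_)
    · exact (PrimrecPred.computablePred (Primrec.eq.comp (Primrec.snd.comp (Primrec.unpair.comp
        (Primrec.snd.comp Primrec.unpair))) (Primrec.const 0))).decide
    · exact partrec_phi.comp (Computable.nat_div2.comp hx) (Computable.const 0)
    · refine Partrec.rfind (Computable.partrec ?_)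
      have h1 : Computable fun r : (ℕ × ℕ × ℕ) × ℕ => r.1.1 :=
        Computable.fst.comp Computable.fst
      have h2 : Computable fun r : (ℕ × ℕ × ℕ) × ℕ => r.1.2.1 :=
        Computable.fst.comp (Computable.snd.comp Computable.fst)
      exact hq.comp ((hn.comp h1).pair (((Computable.nat_div2.comp hx).comp h1).pair
        (h2.pair Computable.snd)))
  obtain ⟨c, hc⟩ := _root_.exists_index hF
  have hW (p : ℕ) : p ∈ W c ↔ (F p).Dom := by rw [W, hc]; rfl
  have hodd (n k y : ℕ) : Nat.pair n (Nat.pair (2 * k + 1) y) ∈ W c ↔ y = 0 ∧ 0 ∈ W k := by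
    have h1 : (2 * k + 1).bodd = true := by simp
    have h2 : (2 * k + 1).div2 = k := by rw [Nat.div2_val]; omega
    simp only [hW, F, Nat.unpair_pair, h1, h2, cond_true]
    by_cases hy0 : y = 0
    · simp [hy0, W]
    · simp [hy0]
  have heven (n k y : ℕ) : Nat.pair n (Nat.pair (2 * k) y) ∈ W c ↔
      ∀ y' < y, ∃ z, q (n, k, y', z) = true := by
    have h1 : (2 * k).bodd = false := by simp
    have h2 : (2 * k).div2 = k := by rw [Nat.div2_val]; omega
    simp only [hW, F, Nat.unpair_pair, h1, h2, cond_false, dom_natRec_bind_iff, hGdom]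
  refine ⟨c, fun n => ?_, fun n k => by simp [hodd]⟩
  rw [hB]
  constructor
  · rintro ⟨x, hx⟩
    refine ⟨2 * x, ?_⟩
    simp only [heven]
    rw [show {y | ∀ y' < y, ∃ z, q (n, x, y', z) = true} = Set.univ from
      Set.eq_univ_of_forall fun y y' _ => hx y']
    exact Set.infinite_univ
  · rintro ⟨x, hx⟩
    obtain ⟨k, rfl | rfl⟩ := x.even_or_odd'
    · refine ⟨k, fun y => ?_⟩
      obtain ⟨y', hy', hlt⟩ := hx.exists_gt y
      exact (heven n k y').1 hy' y hlt
    · exact absurd ((Set.finite_singleton 0).subset fun y hy => ((hodd n k y).1 hy).1) hx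

/-- Whether `m + 1` is the exact number of steps in which `phi c p` converges. -/
def haltsAt (c p m : ℕ) : Bool :=
  haltsWithin (m + 1) c p && !haltsWithin m c p

theorem haltsAt_iff {c p m : ℕ} :
    haltsAt c p m = true ↔ haltsWithin (m + 1) c p = true ∧ ¬ haltsWithin m c p = true := by
  simp [haltsAt]

theorem haltsAt_unique {c p m m' : ℕ} (h : haltsAt c p m = true) (h' : haltsAt c p m' = true) :
    m = m' := by
  rw [haltsAt_iff] at h h'
  rcases lt_trichotomy m m' with hlt | rfl | hlt
  · exact absurd (haltsWithin_mono hlt h.1) h'.2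
  · rfl
  · exact absurd (haltsWithin_mono hlt h'.1) h.2

theorem mem_W_iff_haltsAt {c p : ℕ} : p ∈ W c ↔ ∃ m, haltsAt c p m = true := by
  rw [mem_W_iff_haltsWithin]
  constructor
  · intro h
    classical
    -- Nothing converges in `0` steps, so the least bound is a successor.
    obtain ⟨m, hm⟩ : ∃ m, Nat.find h = m + 1 := by
      refine Nat.exists_eq_succ_of_ne_zero fun h0 => ?_
      have := Nat.find_spec h
      rw [h0] at this
      simp [haltsWithin, evaln] at this
    exact ⟨m, haltsAt_iff.2 ⟨hm ▸ Nat.find_spec h, Nat.find_min h (by omega)⟩⟩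
  · rintro ⟨m, hm⟩
    exact ⟨_, (haltsAt_iff.1 hm).1⟩

/-- At stage `⟨x, y, m⟩` output `x` if `(n, x, y)` enters `W c` in exactly `m + 1` steps;
otherwise output the number of the stage. -/
def sectionCount (c n s : ℕ) : ℕ :=
  bif haltsAt c (Nat.pair n (Nat.pair s.unpair.1 s.unpair.2.unpair.1)) s.unpair.2.unpair.2
  then s.unpair.1 else s

theorem primrec_sectionCount (c : ℕ) {α : Type} [Primcodable α] {n s : α → ℕ} (hn : Primrec n)
    (hs : Primrec s) : Primrec fun a => sectionCount c (n a) (s a) := by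
  have hu := Primrec.unpair.comp hs
  have hu' := Primrec.unpair.comp (Primrec.snd.comp hu)
  have hx := Primrec.fst.comp hu
  have hy := Primrec.fst.comp hu'
  have hm := Primrec.snd.comp hu'
  have hp := Primrec₂.natPair.comp hn (Primrec₂.natPair.comp hx hy)
  exact Primrec.cond (Primrec.and.comp
    (primrec_haltsWithin (Primrec.succ.comp hm) (Primrec.const c) hp)
    (Primrec.not.comp (primrec_haltsWithin hm (Primrec.const c) hp))) hx hs

theorem sectionCount_of_haltsAt {c n x y m : ℕ}
    (h : haltsAt c (Nat.pair n (Nat.pair x y)) m = true) :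
    sectionCount c n (Nat.pair x (Nat.pair y m)) = x := by
  simp [sectionCount, h]

theorem infinite_sectionCount_fiber {c n x : ℕ}
    (h : {y | Nat.pair n (Nat.pair x y) ∈ W c}.Infinite) :
    {s | sectionCount c n s = x}.Infinite := by
  have hex (y : ℕ) (hy : Nat.pair n (Nat.pair x y) ∈ W c) := mem_W_iff_haltsAt.1 hy
  choose! m hm using hex
  refine Set.infinite_of_injOn_mapsTo (f := fun y => Nat.pair x (Nat.pair y (m y))) ?_
    (fun y hy => sectionCount_of_haltsAt (hm y hy)) h
  intro y _ y' _ hyy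
  simpa using congrArg (fun s => s.unpair.2.unpair.1) hyy

/-- Exact halting times give each `y` a single stage, and the default output `s` adds at most the
stage `x` itself to the fiber of `x`. -/
theorem finite_sectionCount_fiber {c n x : ℕ}
    (h : {y | Nat.pair n (Nat.pair x y) ∈ W c}.Finite) :
    {s | sectionCount c n s = x}.Finite := by
  have hex (y : ℕ) (hy : Nat.pair n (Nat.pair x y) ∈ W c) := mem_W_iff_haltsAt.1 hy
  choose! m hm using hex
  refine ((h.image fun y => Nat.pair x (Nat.pair y (m y))).union (Set.finite_singleton x)).subset
    fun s hs => ?_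
  cases hh : haltsAt c (Nat.pair n (Nat.pair s.unpair.1 s.unpair.2.unpair.1)) s.unpair.2.unpair.2
  · right
    simpa [sectionCount, hh] using hs
  · left
    obtain rfl : s.unpair.1 = x := by simpa [sectionCount, hh] using hs
    have hmem := mem_W_iff_haltsAt.2 ⟨_, hh⟩
    refine ⟨s.unpair.2.unpair.1, hmem, ?_⟩
    dsimp only
    rw [haltsAt_unique (hm _ hmem) hh, Nat.pair_unpair, Nat.pair_unpair]

/-- With a computable deficiency set, a nondeficient stage of value at least `2k + 1` can be found.
Any stage showing `0 ∈ W k` has value `2k + 1`, hence comes no later, so a bounded search settles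
halting. -/
theorem not_computablePred_deficiencySet {c n : ℕ}
    (hfin : ∀ x, {y | Nat.pair n (Nat.pair x y) ∈ W c}.Finite)
    (hodd : ∀ k, Nat.pair n (Nat.pair (2 * k + 1) 0) ∈ W c ↔ 0 ∈ W k) :
    ¬ ComputablePred (· ∈ deficiencySet (sectionCount c n)) := by
  intro hD
  have hex (k : ℕ) := exists_notMem_deficiencySet
    (fun v => finite_sectionCount_fiber (hfin v)) (2 * k + 1)
  classical
  have hcomp : Computable fun k => Nat.find (hex k) := by
    refine Computable.find ?_ hex
    refine Computable.computablePred ((Primrec.and.to_comp.comp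
      (Primrec.not.to_comp.comp (hD.decide.comp Computable.snd)) (PrimrecPred.computablePred
        (p := fun r : ℕ × ℕ => 2 * r.1 + 1 ≤ sectionCount c n r.2) (Primrec.nat_le.comp
        (Primrec.succ.comp (Primrec.nat_mul.comp (Primrec.const 2) Primrec.fst))
        (primrec_sectionCount c (Primrec.const n) Primrec.snd))).decide).of_eq fun r => ?_)
    simp
  refine not_computablePred_zero_mem_W (ComputablePred.of_eq (p := fun k => haltsWithin
    (Nat.find (hex k) + 1) c (Nat.pair n (Nat.pair (2 * k + 1) 0)) = true) ?_ fun k => ?_)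
  · refine ComputablePred.computable_iff.2 ⟨_, ?_, rfl⟩
    exact (primrec_haltsWithin (Primrec.succ.comp Primrec.fst) (Primrec.const c)
      (Primrec₂.natPair.comp (Primrec.const n) (Primrec₂.natPair.comp (Primrec.succ.comp
        (Primrec.nat_mul.comp (Primrec.const 2) Primrec.snd)) (Primrec.const 0)))).to_comp.comp
      (hcomp.pair Computable.id)
  · rw [← hodd k]
    refine ⟨fun h => mem_W_iff_haltsWithin.2 ⟨_, h⟩, fun h => ?_⟩
    obtain ⟨m, hm⟩ := mem_W_iff_haltsAt.1 h
    obtain ⟨hs, hle⟩ := Nat.find_spec (hex k)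
    have := le_of_notMem_deficiencySet hs ((sectionCount_of_haltsAt hm).trans_le hle)
    refine haltsWithin_mono (Nat.succ_le_succ ?_) (haltsAt_iff.1 hm).1
    -- The halting time `m` is a component of the stage number, hence bounded by it.
    exact (Nat.right_le_pair 0 m).trans ((Nat.right_le_pair (2 * k + 1) _).trans this)

/-! ### Ceers with a single nontrivial class -/

theorem ceer_iff_of_mem_W_iff {e : ℕ} {C : Set ℕ}
    (h : ∀ x y, Nat.pair x y ∈ W e ↔ x ∈ C ∧ y ∈ C) {x y : ℕ} :
    ceer e x y ↔ x = y ∨ x ∈ C ∧ y ∈ C := by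
  constructor
  · intro hxy
    induction hxy with
    | rel x y hxy => exact Or.inr ((h x y).1 hxy)
    | refl x => exact Or.inl rfl
    | symm x y _ ih => exact ih.imp Eq.symm And.symm
    | trans x y z _ _ ih₁ ih₂ =>
      rcases ih₁ with rfl | ih₁
      · exact ih₂
      · rcases ih₂ with rfl | ih₂
        · exact Or.inr ih₁
        · exact Or.inr ⟨ih₁.1, ih₂.2⟩
  · rintro (rfl | hxy)
    · exact Relation.EqvGen.refl _
    · exact Relation.EqvGen.rel _ _ ((h x y).2 hxy)

/-- For a fixed `a ∈ C`, comparing `f x` with `f a` decides membership in `C`. -/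
theorem computablePred_of_ceerReducible {e : ℕ} {C : Set ℕ}
    (h : ∀ x y, Nat.pair x y ∈ W e ↔ x ∈ C ∧ y ∈ C) (hred : CeerReducible (ceer e) ceerOmega) :
    ComputablePred (· ∈ C) := by
  obtain ⟨f, hf, hfe⟩ := hred
  rcases C.eq_empty_or_nonempty with rfl | ⟨a, ha⟩
  · exact (ComputablePred.computable_iff.2 ⟨_, Computable.const false, rfl⟩).of_eq (by simp)
  · refine ComputablePred.of_eq (p := fun x => f x = f a) ?_ fun x => ?_
    · exact Computable.computablePred ((PrimrecPred.computablePred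
        (p := fun r : ℕ × ℕ => r.1 = r.2) (Primrec.eq.comp Primrec.fst Primrec.snd)).decide.comp
        (hf.pair (Computable.const (f a))))
    · refine (hfe x a).symm.trans ((ceer_iff_of_mem_W_iff h).trans ⟨?_, fun hx => Or.inr ⟨hx, ha⟩⟩)
      rintro (rfl | hx)
      exacts [ha, hx.1]

/-- One direction collapses `C` to `0` and shifts everything else; the other maps into the odd
numbers, which avoid `C`. -/
theorem ceerBireducible_of_computablePred {e : ℕ} {C : Set ℕ}
    (h : ∀ x y, Nat.pair x y ∈ W e ↔ x ∈ C ∧ y ∈ C) (hC : ComputablePred (· ∈ C))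
    (heven : ∀ x ∈ C, Even x) : CeerBireducible (ceer e) ceerOmega := by
  classical
  constructor
  · refine ⟨fun x => if x ∈ C then 0 else x + 1,
      ComputablePred.ite (Computable.const 0) Computable.succ hC, fun x y => ?_⟩
    rw [ceer_iff_of_mem_W_iff h]
    change _ ↔ (if x ∈ C then 0 else x + 1) = if y ∈ C then 0 else y + 1
    by_cases hx : x ∈ C <;> by_cases hy : y ∈ C <;> simp [hx, hy]
    · rintro rfl; exact hy hx
    · rintro rfl; exact hx hy
  · refine ⟨fun x => 2 * x + 1, (Primrec.succ.comp
      (Primrec.nat_mul.comp (Primrec.const 2) Primrec.id)).to_comp, fun x y => ?_⟩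
    rw [ceer_iff_of_mem_W_iff h]
    change x = y ↔ _
    constructor
    · rintro rfl; exact Or.inl rfl
    · rintro (hxy | ⟨hx, -⟩)
      · have hxy' : 2 * x + 1 = 2 * y + 1 := hxy
        omega
      · exact absurd (heven _ hx) (by simp)

/-! ### Completeness -/

/-- This is the s-m-n theorem; injectivity comes from that of `curry` on codes. -/
theorem exists_injective_index {T : ℕ → ℕ → ℕ → Prop}
    (hT : PrimrecPred fun r : ℕ × ℕ × ℕ => T r.1 r.2.1 r.2.2) :
    ∃ g : ℕ → ℕ, Computable g ∧ Function.Injective g ∧ ∀ n p, p ∈ W (g n) ↔ ∃ z, T n p z := by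
  classical
  have hp : Partrec fun q : ℕ =>
      Nat.rfind fun z => Part.some (decide (T q.unpair.1 q.unpair.2 z)) := by
    have hr : Computable fun r : ℕ × ℕ => (r.1.unpair.1, r.1.unpair.2, r.2) :=
      (Computable.fst.comp (Computable.unpair.comp Computable.fst)).pair
        ((Computable.snd.comp (Computable.unpair.comp Computable.fst)).pair Computable.snd)
    exact Partrec.rfind (hT.computablePred.decide.comp hr).partrec
  obtain ⟨c, hc⟩ := exists_code.1 (Partrec.nat_iff.1 hp)
  refine ⟨fun n => encode (curry c n), ?_, fun n m hnm => ?_, fun n p => ?_⟩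
  · exact (Primrec.encode.comp (primrec₂_curry.comp (Primrec.const c) Primrec.id)).to_comp
  · exact (curry_inj (encode_injective hnm)).2
  · simp only [W, phi, Set.mem_ofPred_eq, ofNat_encode, eval_curry, hc, rfind_some_dom,
      Nat.unpair_pair, decide_eq_true_eq]

/-- Every `Σ₃` set is reduced, by an injective computable function, both to `{e | ceer e ≤ ω}` and
to `{e | ceer e ≡ ω}`. -/
theorem IsSigma3.exists_reduction {B : Set ℕ} (hB : IsSigma3 B) :
    ∃ g : ℕ → ℕ, Computable g ∧ Function.Injective g ∧
      (∀ n ∈ B, CeerBireducible (ceer (g n)) ceerOmega) ∧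
      ∀ n, CeerReducible (ceer (g n)) ceerOmega → n ∈ B := by
  obtain ⟨c, hc, hodd⟩ := hB.exists_index
  -- Here `t` witnesses that `a` is twice a deficient stage.
  let M (n a t : ℕ) : Prop :=
    a % 2 = 0 ∧ a / 2 < t ∧ sectionCount c n t ≤ sectionCount c n (a / 2)
  have hM {α : Type} [Primcodable α] {n a t : α → ℕ} (hn : Primrec n) (ha : Primrec a)
      (ht : Primrec t) : PrimrecPred fun r => M (n r) (a r) (t r) := by
    have ha2 : Primrec fun r => a r / 2 := Primrec.nat_div.comp ha (Primrec.const 2)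
    exact (Primrec.eq.comp (Primrec.nat_mod.comp ha (Primrec.const 2)) (Primrec.const 0)).and
      ((Primrec.nat_lt.comp ha2 ht).and
        (Primrec.nat_le.comp (primrec_sectionCount c hn ht) (primrec_sectionCount c hn ha2)))
  obtain ⟨g, hg, hinj, hgW⟩ := exists_injective_index
    (T := fun n p z => M n p.unpair.1 z.unpair.1 ∧ M n p.unpair.2 z.unpair.2) (by
      have hp : Primrec fun r : ℕ × ℕ × ℕ => r.2.1.unpair :=
        Primrec.unpair.comp (Primrec.fst.comp Primrec.snd)
      have hz : Primrec fun r : ℕ × ℕ × ℕ => r.2.2.unpair :=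
        Primrec.unpair.comp (Primrec.snd.comp Primrec.snd)
      exact (hM Primrec.fst (Primrec.fst.comp hp) (Primrec.fst.comp hz)).and
        (hM Primrec.fst (Primrec.snd.comp hp) (Primrec.snd.comp hz)))
  let C (n : ℕ) : Set ℕ := {a | a % 2 = 0 ∧ a / 2 ∈ deficiencySet (sectionCount c n)}
  have hMC (n a : ℕ) : a ∈ C n ↔ ∃ t, M n a t := by simp [C, M, deficiencySet]
  have hgC (n x y : ℕ) : Nat.pair x y ∈ W (g n) ↔ x ∈ C n ∧ y ∈ C n := by
    simp only [hgW, hMC, Nat.unpair_pair]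
    constructor
    · rintro ⟨z, h₁, h₂⟩
      exact ⟨⟨_, h₁⟩, ⟨_, h₂⟩⟩
    · rintro ⟨⟨t₁, h₁⟩, ⟨t₂, h₂⟩⟩
      exact ⟨Nat.pair t₁ t₂, by simpa using ⟨h₁, h₂⟩⟩
  refine ⟨g, hg, hinj, fun n hn => ?_, fun n hn => ?_⟩
  · refine ceerBireducible_of_computablePred (hgC n) ?_ fun x hx => Nat.even_iff.2 hx.1
    obtain ⟨x, hx⟩ := (hc n).1 hn
    have hfin := finite_compl_deficiencySet (infinite_sectionCount_fiber hx)
    have ha2 : Primrec fun a : ℕ => a / 2 := Primrec.nat_div.comp Primrec.id (Primrec.const 2)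
    have hmem : PrimrecPred fun a : ℕ => ∃ s ∈ hfin.toFinset.toList, s = a / 2 :=
      PrimrecPred.comp (f := fun a : ℕ => (hfin.toFinset.toList, a / 2))
        (p := fun r : List ℕ × ℕ => ∃ s ∈ r.1, s = r.2)
        (PrimrecRel.exists_mem_list Primrec.eq) ((Primrec.const _).pair ha2)
    refine ((Primrec.eq.comp (Primrec.nat_mod.comp Primrec.id (Primrec.const 2))
      (Primrec.const 0)).and hmem.not).computablePred.of_eq fun a => ?_
    simp [C]
  · by_contra hnB
    rw [hc, not_exists] at hnB
    refine not_computablePred_deficiencySet (fun x => Set.not_infinite.1 (hnB x)) (hodd n) ?_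
    obtain ⟨q, hq, hqC⟩ :=
      ComputablePred.computable_iff.1 (computablePred_of_ceerReducible (hgC n) hn)
    refine (ComputablePred.computable_iff.2 ⟨_, hq.comp
      (Primrec.nat_mul.comp (Primrec.const 2) Primrec.id).to_comp, rfl⟩).of_eq fun s => ?_
    have := congrFun hqC (2 * s)
    simp only [id] at this ⊢
    rw [← this]
    simp [C]

theorem corollary4p8 :
    IsSigma3Complete {p : ℕ × ℕ | CeerReducible (ceer p.1) (ceer p.2)} ∧
    IsSigma3Complete {p : ℕ × ℕ | CeerBireducible (ceer p.1) (ceer p.2)} ∧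
    IsSigma3Complete {e : ℕ | CeerBireducible (ceer e) ceerOmega} := by
  obtain ⟨i, hi⟩ := exists_ceer_eq_ceerOmega
  refine ⟨⟨isSigma3_ceerReducible, fun B hB => ?_⟩, ⟨isSigma3_ceerBireducible, fun B hB => ?_⟩,
    ⟨?_, fun B hB => ?_⟩⟩
  · obtain ⟨g, hg, hinj, h₁, h₂⟩ := hB.exists_reduction
    refine ⟨fun n => (g n, i), hg.pair (Computable.const i),
      fun n m hnm => hinj (Prod.ext_iff.1 hnm).1, fun n => ?_⟩
    change n ∈ B ↔ CeerReducible (ceer (g n)) (ceer i)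
    rw [hi]
    exact ⟨fun hn => (h₁ n hn).1, h₂ n⟩
  · obtain ⟨g, hg, hinj, h₁, h₂⟩ := hB.exists_reduction
    refine ⟨fun n => (g n, i), hg.pair (Computable.const i),
      fun n m hnm => hinj (Prod.ext_iff.1 hnm).1, fun n => ?_⟩
    change n ∈ B ↔ CeerBireducible (ceer (g n)) (ceer i)
    rw [hi]
    exact ⟨h₁ n, fun hn => h₂ n hn.1⟩
  · have := isSigma3_ceerBireducible.preimage (f := fun e => (e, i))
      (Computable.id.pair (Computable.const i))
    simpa only [Set.preimage_ofPred_eq, hi] using this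
  · obtain ⟨g, hg, hinj, h₁, h₂⟩ := hB.exists_reduction
    exact ⟨g, hg, hinj, fun n => ⟨h₁ n, fun hn => h₂ n hn.1⟩⟩
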